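/- Let $\mathbb{F}_q$ be a finite field of characteristic $p\notin\{2,5\}$. Call a polynomial $f\in\mathbb{F}_q[x]$ an orthomorphism polynomial if both maps $x\mapsto f(x)$ and $x\mapsto f(x)-x$ are permutations of $\mathbb{F}_q$, and for $f,g\in\mathbb{F}_q[x]$ let $H(f,g)=\bigl|\{a\in\mathbb{F}_q : f(a)\neq g(a)\}\bigr|$ denote their Hamming distance. Then there exist orthomorphism polynomials $f,g\in\mathbb{F}_q[x]$ with $H(f,g)=3$. -/

import Mathlib

open Polynomial

/-- `f` is a permutation polynomial over `F`: evaluation of `f` is a permutation of `F`. -/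
def IsPermutationPolynomial {F : Type*} [Field F] (f : F[X]) : Prop :=
  Function.Bijective (fun x : F => f.eval x)

/-- `f` is an orthomorphism polynomial over `F`: both `x ↦ f(x)` and `x ↦ f(x) - x` are
permutations of `F`. -/
def IsOrthomorphismPolynomial {F : Type*} [Field F] (f : F[X]) : Prop :=
  IsPermutationPolynomial f ∧ Function.Bijective (fun x : F => f.eval x - x)

/-- The Hamming distance of `f` and `g`: the number of points of `F` (used for finite `F` only) at
which their values differ. -/
noncomputable def polyHammingDist {F : Type*} [Field F] (f g : F[X]) : ℕ :=
  Set.ncard {a : F | f.eval a ≠ g.eval a}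

/-! Cycling three values of an orthomorphism `h` permutes the values of `h`. If two linear relations
at `a, b, c` hold, it also permutes those of `h x - x`, cycling them the opposite way, so the result
is an orthomorphism at distance 3 (`exists_orthomorphism_pair_of_triple`). It remains to find `h`
and a triple. If -3 is a square, a linear `h` works. Otherwise `h` gets two slopes, one on each
coset of the squares; the relations determine the slopes from the triple, and quadratic character
conditions make `h` an orthomorphism. If -1 is a nonsquare, a triple `0, 1, c` works; if -1 is a
square, 3 is not, and explicit integers do. -/

/-- The maps `x ↦ s * x` on one multiplicative coset of the squares and `x ↦ t * x` off it
are glued to an injective map whenever `s * t` is a nonzero square. -/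
theorem injective_ite_isSquare_mul {F : Type*} [Field F] [Fintype F] [DecidableEq F]
    {u s t : F} (hst : quadraticChar F (s * t) = 1) :
    Function.Injective
      (fun x : F => (if quadraticChar F (u * x) = 1 then s else t) * x) := by
  have hst0 : s * t ≠ 0 := by
    intro h
    simp [h] at hst
  have hs : s ≠ 0 := left_ne_zero_of_mul hst0
  have ht : t ≠ 0 := right_ne_zero_of_mul hst0
  have heq : quadraticChar F s = quadraticChar F t := by
    rw [map_mul] at hst
    rcases quadraticChar_dichotomy hs with h1 | h1 <;>
      rcases quadraticChar_dichotomy ht with h2 | h2 <;> simp_all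
  -- As `s` and `t` have equal character, the two pieces have images in different cosets.
  have key : ∀ x y : F, quadraticChar F (u * x) = 1 → quadraticChar F (u * y) ≠ 1 →
      s * x ≠ t * y := by
    intro x y hx hy h
    apply hy
    have h1 := congrArg (quadraticChar F) h
    rw [map_mul, map_mul, heq] at h1
    rw [map_mul, ← mul_left_cancel₀ ((quadraticChar_eq_zero_iff).not.mpr ht) h1, ← map_mul, hx]
  intro x y h
  simp only at h
  split_ifs at h with h1 h2 h2
  · exact mul_left_cancel₀ hs h
  · exact (key x y h1 h2 h).elim
  · exact (key y x h2 h1 h.symm).elim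
  · exact mul_left_cancel₀ ht h

/-- A piecewise linear map with two slopes `s`, `t`, divided according to the quadratic character,
is an orthomorphism if `s * t` and `(s - 1) * (t - 1)` are nonzero squares. -/
theorem bijective_quadratic_orthomorphism {F : Type*} [Field F] [Fintype F] [DecidableEq F]
    {u s t : F} (hst : quadraticChar F (s * t) = 1)
    (hst' : quadraticChar F ((s - 1) * (t - 1)) = 1) :
    Function.Bijective (fun x : F => (if quadraticChar F (u * x) = 1 then s else t) * x) ∧
    Function.Bijective
      (fun x : F => (if quadraticChar F (u * x) = 1 then s else t) * x - x) := by
  refine ⟨Finite.injective_iff_bijective.mp (injective_ite_isSquare_mul hst),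
    Finite.injective_iff_bijective.mp ?_⟩
  convert injective_ite_isSquare_mul (u := u) hst' using 2 with x
  split_ifs <;> ring

theorem exists_polynomial_eval_eq {F : Type*} [Field F] [Finite F] (h : F → F) :
    ∃ f : F[X], ∀ x, f.eval x = h x := by
  classical
  have := Fintype.ofFinite F
  exact ⟨Lagrange.interpolate Finset.univ id h, fun x =>
    Lagrange.eval_interpolate_at_node h (Set.injOn_id _) (Finset.mem_univ x)⟩

/-- Cyclically permuting three suitable values of an orthomorphism gives another one. -/
theorem exists_orthomorphism_pair_of_triple {F : Type*} [Field F] [Finite F] {h : F → F}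
    (h1 : Function.Bijective h) (h2 : Function.Bijective (fun x => h x - x)) {a b c : F}
    (hab : a ≠ b) (hac : a ≠ c) (hbc : b ≠ c)
    (e1 : h b - h a = b - c) (e2 : h c - h b = c - a) :
    ∃ f g : F[X], IsOrthomorphismPolynomial f ∧ IsOrthomorphismPolynomial g ∧
      polyHammingDist f g = 3 := by
  classical
  let σ : Equiv.Perm F := Equiv.swap a b * Equiv.swap b c
  let τ : Equiv.Perm F := Equiv.swap b c * Equiv.swap a b
  have σa : σ a = b := by
    simp [σ, Equiv.swap_apply_of_ne_of_ne hab hac]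
  have σb : σ b = c := by
    simp [σ, Equiv.swap_apply_of_ne_of_ne hac.symm hbc.symm]
  have σc : σ c = a := by simp [σ]
  have τa : τ a = c := by simp [τ]
  have τb : τ b = a := by simp [τ, Equiv.swap_apply_of_ne_of_ne hab hac]
  have τc : τ c = b := by simp [τ, Equiv.swap_apply_of_ne_of_ne hac.symm hbc.symm]
  have σo : ∀ x, x ≠ a → x ≠ b → x ≠ c → σ x = x := fun x xa xb xc => by
    simp [σ, Equiv.swap_apply_of_ne_of_ne, xa, xb, xc]
  have τo : ∀ x, x ≠ a → x ≠ b → x ≠ c → τ x = x := fun x xa xb xc => by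
    simp [τ, Equiv.swap_apply_of_ne_of_ne, xa, xb, xc]
  obtain ⟨f, hf⟩ := exists_polynomial_eval_eq h
  obtain ⟨g, hg⟩ := exists_polynomial_eval_eq (h ∘ σ)
  refine ⟨f, g, ⟨?_, ?_⟩, ⟨?_, ?_⟩, ?_⟩
  · simpa only [IsPermutationPolynomial, hf] using h1
  · simpa only [hf] using h2
  · simpa only [IsPermutationPolynomial, hg] using h1.comp σ.bijective
  -- `τ` is the inverse of `σ`; `e1` and `e2` say exactly that the differences match at `c`, `a` and
  -- hence `b`.
  · have : (fun x => g.eval x - x) = (fun x => h x - x) ∘ τ := by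
      funext x
      simp only [hg, Function.comp_apply]
      by_cases xa : x = a
      · rw [xa, σa, τa]; linear_combination -e2
      by_cases xb : x = b
      · rw [xb, σb, τb]; linear_combination e1 + e2
      by_cases xc : x = c
      · rw [xc, σc, τc]; linear_combination -e1
      rw [σo x xa xb xc, τo x xa xb xc]
    rw [this]
    exact h2.comp τ.bijective
  · have : {x : F | f.eval x ≠ g.eval x} = {a, b, c} := by
      ext x
      simp only [hf, hg, Function.comp_apply, Set.mem_ofPred_eq, h1.injective.ne_iff,
        Set.mem_insert_iff, Set.mem_singleton_iff]
      constructor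
      · intro hx
        by_contra! hn
        exact hx (σo x hn.1 hn.2.1 hn.2.2).symm
      · rintro (rfl | rfl | rfl)
        · rwa [σa]
        · rwa [σb]
        · rw [σc]; exact hac.symm
    rw [polyHammingDist, this, Set.ncard_eq_three]
    exact ⟨a, b, c, hab, hac, hbc, rfl⟩

/-- A triple with `a * c` and `b * c` nonsquare, for which the two slopes forced by the exchange
condition define a quadratic orthomorphism. -/
theorem exists_orthomorphism_pair_of_quadraticChar {F : Type*} [Field F] [Fintype F]
    [DecidableEq F] {a b c : F} (hab : a ≠ b)
    (hac : quadraticChar F (a * c) = -1) (hbc : quadraticChar F (b * c) = -1)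
    (h1 : quadraticChar F (c * (b - c) * (a ^ 2 - a * b + b ^ 2 - a * c)) = 1)
    (h2 : quadraticChar F (c * (a - c) * (a ^ 2 - a * b + b ^ 2 - b * c)) = 1) :
    ∃ f g : F[X], IsOrthomorphismPolynomial f ∧ IsOrthomorphismPolynomial g ∧
      polyHammingDist f g = 3 := by
  have hc : c ≠ 0 := by
    rintro rfl
    simp at hac
  have hac' : a ≠ c := by
    rintro rfl
    simp at h2
  have hbc' : b ≠ c := by
    rintro rfl
    simp at h1
  have hd : b - a ≠ 0 := sub_ne_zero.mpr hab.symm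
  -- `a` and `b` lie off the coset of `c`, so the relations read `t(b - a) = b - c` and `sc - tb = c
  -- - a`; these are their solutions.
  set s : F := (a ^ 2 - a * b + b ^ 2 - a * c) / (c * (b - a)) with hs
  set t : F := (b - c) / (b - a) with ht
  have hsq : quadraticChar F ((c * (b - a)) ^ 2) = 1 :=
    quadraticChar_sq_one' (mul_ne_zero hc hd)
  have hst : quadraticChar F (s * t) = 1 := by
    have e : c * (b - c) * (a ^ 2 - a * b + b ^ 2 - a * c) = (c * (b - a)) ^ 2 * (s * t) := by
      rw [hs, ht]; field_simp
    rwa [e, map_mul, hsq, one_mul] at h1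
  have hst' : quadraticChar F ((s - 1) * (t - 1)) = 1 := by
    have e : c * (a - c) * (a ^ 2 - a * b + b ^ 2 - b * c)
        = (c * (b - a)) ^ 2 * ((s - 1) * (t - 1)) := by
      rw [hs, ht]; field_simp; ring
    rwa [e, map_mul, hsq, one_mul] at h2
  obtain ⟨hb1, hb2⟩ := bijective_quadratic_orthomorphism (u := c) hst hst'
  have hcc : quadraticChar F (c * c) = 1 := by
    rw [← sq]; exact quadraticChar_sq_one' hc
  refine exists_orthomorphism_pair_of_triple hb1 hb2 hab hac' hbc' ?_ ?_
  · simp only [mul_comm c, hac, hbc]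
    norm_num
    rw [ht]; field_simp
  · simp only [mul_comm c b, hbc, hcc]
    norm_num
    rw [hs, ht]; field_simp; ring

/-- For linear `h` and the triple `0, 1, c`, the first relation forces slope `1 - c`, and the second
becomes `c ^ 2 - c + 1 = 0`. -/
theorem exists_orthomorphism_pair_of_root {F : Type*} [Field F] [Finite F] {c : F}
    (hc : c ^ 2 - c + 1 = 0) :
    ∃ f g : F[X], IsOrthomorphismPolynomial f ∧ IsOrthomorphismPolynomial g ∧
      polyHammingDist f g = 3 := by
  have hc0 : c ≠ 0 := by
    rintro rfl
    simp at hc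
  have hc1 : c ≠ 1 := by
    rintro rfl
    simp at hc
  have hc1' : 1 - c ≠ 0 := sub_ne_zero.mpr hc1.symm
  refine exists_orthomorphism_pair_of_triple (h := fun x => (1 - c) * x)
    (a := 0) (b := 1) (c := c) (mulLeft_bijective₀ _ hc1') ?_ zero_ne_one hc0.symm hc1.symm
    (by ring) (by linear_combination -hc)
  convert mulLeft_bijective₀ (-c) (neg_ne_zero.mpr hc0) using 2 with x
  ring

/-- If `-1` is not a square then some `c` and `1 - c` are both nonsquares. -/
theorem exists_not_isSquare_one_sub {F : Type*} [Field F] [Fintype F] [DecidableEq F]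
    (h : quadraticChar F (-1) = -1) :
    ∃ c : F, quadraticChar F c = -1 ∧ quadraticChar F (1 - c) = -1 := by
  by_contra! hn
  -- If `n` is a nonzero square then `-n` is a nonsquare, so `1 - (-n) = n + 1` must be a square.
  -- Thus the whole prime field, including -1, would consist of squares.
  have hsq : ∀ n : ℕ, IsSquare (n : F) := by
    intro n
    induction n with
    | zero => simp
    | succ n ih =>
      by_cases h0 : (n : F) = 0
      · simp [h0]
      have h1 : quadraticChar F (-(n : F)) = -1 := by
        rw [← neg_one_mul, map_mul, h, (quadraticChar_one_iff_isSquare h0).mpr ih, mul_one]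
      have h2 := hn _ h1
      rw [sub_neg_eq_add, add_comm] at h2
      rw [Ne, quadraticChar_neg_one_iff_not_isSquare, not_not] at h2
      exact_mod_cast h2
  have hlast : ((ringChar F - 1 : ℕ) : F) = -1 := by
    rw [Nat.cast_sub (CharP.char_is_prime F (ringChar F)).one_le]
    simp
  exact quadraticChar_neg_one_iff_not_isSquare.mp h (hlast ▸ hsq _)

/-- With 1 and `c` in different cosets, the triple `0, 1, c` forces slopes `1 - c` and `c⁻¹`. The
orthomorphism conditions ask that `(1 - c) / c` and `-(1 - c)` be squares, which holds when `c`, `1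
- c` and -1 are nonsquares. -/
theorem exists_orthomorphism_pair_of_neg_one_nonsquare {F : Type*} [Field F] [Fintype F]
    [DecidableEq F] (h : quadraticChar F (-1) = -1) :
    ∃ f g : F[X], IsOrthomorphismPolynomial f ∧ IsOrthomorphismPolynomial g ∧
      polyHammingDist f g = 3 := by
  obtain ⟨c, hc, hc'⟩ := exists_not_isSquare_one_sub h
  have hc0 : c ≠ 0 := by
    rintro rfl
    simp at hc
  have hc1 : c ≠ 1 := by
    rintro rfl
    simp at hc
  have hinv : quadraticChar F c⁻¹ = -1 := by
    have : quadraticChar F (c * c⁻¹) = 1 := by rw [mul_inv_cancel₀ hc0, map_one]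
    rw [map_mul, hc] at this
    linarith
  obtain ⟨hb1, hb2⟩ := bijective_quadratic_orthomorphism (u := 1) (s := 1 - c) (t := c⁻¹)
    (by rw [map_mul, hc', hinv]; norm_num)
    (by
      rw [show (1 - c - 1) * (c⁻¹ - 1) = -1 * (1 - c) by field_simp; ring, map_mul, h, hc']
      norm_num)
  refine exists_orthomorphism_pair_of_triple hb1 hb2 (a := 0) (b := 1) (c := c)
    zero_ne_one hc0.symm hc1.symm ?_ ?_
  · simp
  · simp only [one_mul, hc, map_one]
    norm_num
    field_simp
    ring

/-- The remaining fields: `-1` is a square and `3` is not. Three integral triples suffice,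
according to the quadratic characters of `2` and `5`. -/
theorem exists_orthomorphism_pair_of_three_nonsquare {F : Type*} [Field F] [Fintype F]
    [DecidableEq F] (hm : quadraticChar F (-1) = 1) (h3 : quadraticChar F 3 = -1)
    (n2 : (2 : F) ≠ 0) (n5 : (5 : F) ≠ 0) (n7 : (7 : F) ≠ 0) (n11 : (11 : F) ≠ 0) :
    ∃ f g : F[X], IsOrthomorphismPolynomial f ∧ IsOrthomorphismPolynomial g ∧
      polyHammingDist f g = 3 := by
  have n3 : (3 : F) ≠ 0 := by
    intro h
    simp [h] at h3
  have hsq : ∀ m x : F, m ≠ 0 → quadraticChar F (m ^ 2 * x) = quadraticChar F x := by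
    intro m x h
    rw [map_mul, quadraticChar_sq_one' h, one_mul]
  rcases quadraticChar_dichotomy n2 with h2 | h2
  · rcases quadraticChar_dichotomy n5 with h5 | h5
    -- For each triple, the four quantities are squares times products of -1, 2, 3, 5, so their
    -- characters are known.
    · refine exists_orthomorphism_pair_of_quadraticChar (a := -25) (b := 10) (c := 3) ?_ ?_ ?_ ?_ ?_
      · intro h
        exact mul_ne_zero n5 n7 (by linear_combination -h)
      · rw [show (-25 * 3 : F) = 5 ^ 2 * (-1 * 3) by norm_num, hsq _ _ n5, map_mul, hm, h3]
        norm_num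
      · rw [show (10 * 3 : F) = 2 * 5 * 3 by norm_num, map_mul, map_mul, h2, h5, h3]
        norm_num
      · rw [← h2, ← hsq (3 * 5 * 7) 2 (mul_ne_zero (mul_ne_zero n3 n5) n7)]
        norm_num
      · rw [show (1 : ℤ) = quadraticChar F (-1 * 5) by rw [map_mul, hm, h5, one_mul],
          ← hsq (3 ^ 2 * 2 * 7) (-1 * 5) (mul_ne_zero (mul_ne_zero (pow_ne_zero 2 n3) n2) n7)]
        norm_num
    · refine exists_orthomorphism_pair_of_quadraticChar (a := 1) (b := 2) (c := 6) ?_ ?_ ?_ ?_ ?_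
      · intro h
        exact one_ne_zero (α := F) (by linear_combination -h)
      · rw [show (1 * 6 : F) = 2 * 3 by norm_num, map_mul, h2, h3]
        norm_num
      · rw [show (2 * 6 : F) = 2 ^ 2 * 3 by norm_num, hsq _ _ n2, h3]
      · rw [← h2, ← hsq (2 * 3) 2 (mul_ne_zero n2 n3)]
        norm_num
      · rw [show (1 : ℤ) = quadraticChar F (2 * 3 * 5) by
            rw [map_mul, map_mul, h2, h3, h5]; norm_num,
          ← hsq 3 (2 * 3 * 5) n3]
        norm_num
  · refine exists_orthomorphism_pair_of_quadraticChar (a := -9) (b := 24) (c := 2) ?_ ?_ ?_ ?_ ?_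
    · intro h
      exact mul_ne_zero n3 n11 (by linear_combination -h)
    · rw [show (-9 * 2 : F) = 3 ^ 2 * (-1 * 2) by norm_num, hsq _ _ n3, map_mul, hm, h2]
      norm_num
    · rw [show (24 * 2 : F) = (2 ^ 2) ^ 2 * 3 by norm_num, hsq _ _ (pow_ne_zero 2 n2), h3]
    · rw [← map_one (quadraticChar F),
        ← hsq (2 * 3 ^ 2 * 11) 1 (mul_ne_zero (mul_ne_zero n2 (pow_ne_zero 2 n3)) n11)]
      norm_num
    · rw [show (1 : ℤ) = quadraticChar F (-1 * 2 * 3) by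
          rw [map_mul, map_mul, hm, h2, h3]; norm_num,
        ← hsq (5 * 11) (-1 * 2 * 3) (mul_ne_zero n5 n11)]
      norm_num

theorem ofNat_prime_ne_zero_of_charP {F : Type*} [Field F] {p : ℕ} [CharP F p] {r : ℕ}
    (hr : r.Prime) (hp : p ≠ r) : (r : F) ≠ 0 := by
  intro h
  rcases (Nat.dvd_prime hr).mp ((CharP.cast_eq_zero_iff F p r).mp h) with h | h
  · exact CharP.char_ne_one F p h
  · exact hp h

theorem theorem2p2 {F : Type*} [Field F] [Finite F] (p : ℕ) [CharP F p]
    (hp2 : p ≠ 2) (hp5 : p ≠ 5) :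
    ∃ f g : F[X], IsOrthomorphismPolynomial f ∧ IsOrthomorphismPolynomial g ∧
      polyHammingDist f g = 3 := by
  classical
  have := Fintype.ofFinite F
  have n2 : (2 : F) ≠ 0 := by exact_mod_cast ofNat_prime_ne_zero_of_charP Nat.prime_two hp2
  have n5 : (5 : F) ≠ 0 := by exact_mod_cast ofNat_prime_ne_zero_of_charP Nat.prime_five hp5
  -- -3 is the discriminant of `c ^ 2 - c + 1`; characteristic 3 falls in this case, since 0 is a
  -- square.
  by_cases hsq : IsSquare (-3 : F)
  · obtain ⟨r, hr⟩ := hsq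
    refine exists_orthomorphism_pair_of_root (c := (1 + r) / 2) ?_
    field_simp
    linear_combination -hr
  have h3' := quadraticChar_neg_one_iff_not_isSquare.mpr hsq
  rcases quadraticChar_dichotomy (neg_ne_zero.mpr (one_ne_zero (α := F))) with hm | hm
  · obtain ⟨i, hi⟩ := (quadraticChar_one_iff_isSquare (neg_ne_zero.mpr one_ne_zero)).mp hm
    refine exists_orthomorphism_pair_of_three_nonsquare hm ?_ n2 n5 ?_ ?_
    · rwa [← neg_one_mul, map_mul, hm, one_mul] at h3'
    -- Characteristics 7 and 11 cannot occur: there -3 equals `2 ^ 2` and `-25 = (5 * i) ^ 2`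
    -- respectively.
    · intro h
      exact hsq ⟨2, by linear_combination -h⟩
    · intro h
      exact hsq ⟨5 * i, by linear_combination 2 * h + 25 * hi⟩
  · exact exists_orthomorphism_pair_of_neg_one_nonsquare hm
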